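/- Let $d\ge 4$, let $U\subseteq\mathbb{R}^2$ be open, and let $W$ be a smooth planar $d$-web on $U$, i.e. $d$ smooth ($C^\infty$) one-dimensional foliations of $U$ whose tangent lines at every point of $U$ are pairwise distinct. For a planar $4$-web whose foliations are given near a point by nonvanishing $1$-forms $\omega_1,\omega_2,\omega_3,\omega_4$ (the leaves being tangent to $\ker\omega_i$), rescale the forms by nonvanishing functions so that $\omega_1+\omega_2+\omega_3=0$ and $a\,\omega_1+\omega_2+\omega_4=0$; the function $a$ is uniquely determined by the $4$-web and is called its basic invariant (it is the cross-ratio of the four lines spanned by $\omega_1,\dots,\omega_4$ in the cotangent spaces). The web $W$ is called linearizable (respectively parallelizable) if every point of $U$ has a neighbourhood on which some smooth local diffeomorphism of the plane sends $W$ to a $d$-web all of whose leaves are pieces of straight lines (respectively, to a $d$-web each of whose foliations consists of pieces of mutually parallel straight lines). Suppose that the basic invariant of every $4$-subweb of $W$ (formed by four of the $d$ foliations, taken in their given order) is constant on $U$. Then $W$ is linearizable if and only if $W$ is parallelizable. -/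

import Mathlib

open scoped ContDiff

/-- The real plane `ℝ²`. -/
abbrev Plane : Type := ℝ × ℝ

/-- A smooth one-dimensional foliation of an open set `U` of the plane, given by its field of
tangent lines: near every point of `U` it is the kernel of a nowhere vanishing smooth
differential `1`-form. (In the plane every such field of lines is integrable.) The values of
`dir` outside `U` are irrelevant. -/
structure PlaneFoliation (U : TopologicalSpace.Opens Plane) where
  /-- the tangent line of the leaf through a point -/
  dir : Plane → Submodule ℝ Plane
  smooth : ∀ p ∈ U, ∃ V : TopologicalSpace.Opens Plane, p ∈ V ∧ V ≤ U ∧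
    ∃ θ : Plane → (Plane →L[ℝ] ℝ), ContDiffOn ℝ ∞ θ V ∧
      ∀ q ∈ V, θ q ≠ 0 ∧ dir q = LinearMap.ker (θ q).toLinearMap

/-- The leaves of the foliation are (pieces of) straight lines: whenever a segment in `U` starts
at `q` in the direction of the leaf through `q`, the foliation is tangent to that segment
along it, so that the segment lies in the leaf. -/
def PlaneFoliation.IsStraight {U : TopologicalSpace.Opens Plane} (F : PlaneFoliation U) : Prop :=
  ∀ q r : Plane, segment ℝ q r ⊆ (U : Set Plane) → r - q ∈ F.dir q → F.dir r = F.dir q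

/-- The leaves of the foliation are (pieces of) straight lines that are parallel to each other:
the direction of the leaves is the same at all points. -/
def PlaneFoliation.IsParallel {U : TopologicalSpace.Opens Plane} (F : PlaneFoliation U) : Prop :=
  ∀ q ∈ U, ∀ r ∈ U, F.dir q = F.dir r

/-- A planar `d`-web on an open set `U`: `d` smooth one-dimensional foliations in general
position, i.e. with pairwise distinct directions at every point. -/
structure PlanarWeb (d : ℕ) (U : TopologicalSpace.Opens Plane) where
  fol : Fin d → PlaneFoliation U
  general_position : ∀ q ∈ U, ∀ i j : Fin d, i ≠ j → (fol i).dir q ≠ (fol j).dir q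

namespace PlanarWeb

variable {d : ℕ} {U : TopologicalSpace.Opens Plane}

/-- The `k`-subweb formed by `k` of the `d` foliations, taken in their given order. -/
def subweb {k : ℕ} (W : PlanarWeb d U) (e : Fin k ↪o Fin d) : PlanarWeb k U where
  fol i := W.fol (e i)
  general_position q hq i j hij :=
    W.general_position q hq (e i) (e j) fun h => hij (e.injective h)

/-- A web is linear if the leaves of all its foliations are straight lines. -/
def IsLinear (W : PlanarWeb d U) : Prop := ∀ i, (W.fol i).IsStraight

/-- A web of parallel straight lines: each of its foliations consists of parallel lines. -/
def IsParallel (W : PlanarWeb d U) : Prop := ∀ i, (W.fol i).IsParallel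

/-- A smooth local diffeomorphism, defined on a neighbourhood of `p` in `U` and with values in
`U'`, sends the web `W` on `U` to the web `W'` on `U'`. -/
def LocallyEquivalentAt {U' : TopologicalSpace.Opens Plane} (W : PlanarWeb d U)
    (W' : PlanarWeb d U') (p : Plane) : Prop :=
  ∃ φ : OpenPartialHomeomorph Plane Plane,
    p ∈ φ.source ∧ φ.source ⊆ (U : Set Plane) ∧ φ.target ⊆ (U' : Set Plane) ∧
    ContDiffOn ℝ ∞ φ φ.source ∧ ContDiffOn ℝ ∞ φ.symm φ.target ∧
    ∀ q ∈ φ.source, ∀ i,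
      (W'.fol i).dir (φ q) = ((W.fol i).dir q).map (fderiv ℝ φ q).toLinearMap

/-- A web is (locally) linearizable if near every point of its domain it is equivalent to a
linear web. -/
def IsLinearizable (W : PlanarWeb d U) : Prop :=
  ∀ p ∈ U, ∃ (U' : TopologicalSpace.Opens Plane) (W' : PlanarWeb d U'),
    W'.IsLinear ∧ W.LocallyEquivalentAt W' p

/-- A web is (locally) parallelizable if near every point of its domain it is equivalent to a
web of parallel straight lines. -/
def IsParallelizable (W : PlanarWeb d U) : Prop :=
  ∀ p ∈ U, ∃ (U' : TopologicalSpace.Opens Plane) (W' : PlanarWeb d U'),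
    W'.IsParallel ∧ W.LocallyEquivalentAt W' p

/-- The number `a` is a value at `q` of the basic invariant of the `4`-web `W`: there are nonzero
covectors `η 0, η 1, η 2, η 3` at `q` that define the four foliations and satisfy the
normalizations `η 0 + η 1 + η 2 = 0` and `a • η 0 + η 1 + η 3 = 0`. -/
def IsBasicInvariantAt (W : PlanarWeb 4 U) (q : Plane) (a : ℝ) : Prop :=
  ∃ η : Fin 4 → (Plane →L[ℝ] ℝ),
    (∀ i, η i ≠ 0 ∧ (W.fol i).dir q = LinearMap.ker (η i).toLinearMap) ∧
    η 0 + η 1 + η 2 = 0 ∧ a • η 0 + η 1 + η 3 = 0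

open Classical in
/-- The basic invariant of a `4`-web, as a function on its domain (and `0` outside it, should the
normalization be impossible there). -/
noncomputable def basicInvariant (W : PlanarWeb 4 U) (q : Plane) : ℝ :=
  if h : ∃ a, W.IsBasicInvariantAt q a then h.choose else 0

theorem ker_eq_of_det_eq_zero {α β : Plane →L[ℝ] ℝ} (hα : α ≠ 0) (hβ : β ≠ 0)
    (h : α (1, 0) * β (0, 1) - α (0, 1) * β (1, 0) = 0) :
    LinearMap.ker α.toLinearMap = LinearMap.ker β.toLinearMap := by
  have key : ∀ (γ : Plane →L[ℝ] ℝ) (v : Plane), γ v = v.1 * γ (1, 0) + v.2 * γ (0, 1) := by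
    intro γ v
    have hv : v = v.1 • ((1, 0) : Plane) + v.2 • ((0, 1) : Plane) := by
      ext <;> simp
    conv_lhs => rw [hv]
    rw [map_add, map_smul, map_smul, smul_eq_mul, smul_eq_mul]
  have ne : ∀ γ : Plane →L[ℝ] ℝ, γ ≠ 0 → γ (1, 0) ≠ 0 ∨ γ (0, 1) ≠ 0 := by
    intro γ hγ
    by_contra! hc
    exact hγ (by ext <;> simp [hc.1, hc.2])
  ext v
  simp only [LinearMap.mem_ker, ContinuousLinearMap.coe_coe]
  rw [key α v, key β v]
  have aux : ∀ a b c e x y : ℝ, a * e - b * c = 0 → (c ≠ 0 ∨ e ≠ 0) → (a ≠ 0 ∨ b ≠ 0) →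
      x * a + y * b = 0 → x * c + y * e = 0 := by
    intro a b c e x y h _ h2 h3
    rcases h2 with h2 | h2
    · apply mul_left_cancel₀ h2
      linear_combination c * h3 + y * h
    · apply mul_left_cancel₀ h2
      linear_combination e * h3 - x * h
  constructor
  · exact aux _ _ _ _ _ _ h (ne β hβ) (ne α hα)
  · exact aux _ _ _ _ _ _ (by linear_combination -h) (ne α hα) (ne β hβ)

/-- At every point of its domain a `4`-web has exactly one basic invariant. -/
theorem existsUnique_isBasicInvariantAt (W : PlanarWeb 4 U) {q : Plane} (hq : q ∈ U) :
    ∃! a, W.IsBasicInvariantAt q a := by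
  have det_ne : ∀ η : Fin 4 → (Plane →L[ℝ] ℝ),
      (∀ i, η i ≠ 0 ∧ (W.fol i).dir q = LinearMap.ker (η i).toLinearMap) →
      ∀ i j, i ≠ j → η i (1, 0) * η j (0, 1) - η i (0, 1) * η j (1, 0) ≠ 0 := by
    intro η hη i j hij h
    refine W.general_position q hq i j hij ?_
    rw [(hη i).2, (hη j).2]
    exact ker_eq_of_det_eq_zero (hη i).1 (hη j).1 h
  have hθ : ∀ i, ∃ θ : Plane →L[ℝ] ℝ, θ ≠ 0 ∧
      (W.fol i).dir q = LinearMap.ker θ.toLinearMap := by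
    intro i
    obtain ⟨V, hV, -, θ, -, h⟩ := (W.fol i).smooth q hq
    exact ⟨θ q, h q hV⟩
  choose θ hθ using hθ
  have D := det_ne θ hθ
  refine existsUnique_of_exists_of_unique ?_ ?_
  · have hsm : ∀ (i : Fin 4) (c : ℝ), c ≠ 0 → c • θ i ≠ 0 ∧
        (W.fol i).dir q = LinearMap.ker (c • θ i).toLinearMap := by
      intro i c hc
      refine ⟨smul_ne_zero hc (hθ i).1, ?_⟩
      rw [(hθ i).2]
      ext v
      simp [hc]
    have d01 := D 0 1 (by decide)
    have d02 := D 0 2 (by decide)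
    have d03 := D 0 3 (by decide)
    have d12 := D 1 2 (by decide)
    have d13 := D 1 3 (by decide)
    set x0 := θ 0 (1, 0)
    set x1 := θ 1 (1, 0)
    set x2 := θ 2 (1, 0)
    set x3 := θ 3 (1, 0)
    set y0 := θ 0 (0, 1)
    set y1 := θ 1 (0, 1)
    set y2 := θ 2 (0, 1)
    set y3 := θ 3 (0, 1)
    refine ⟨((x0 * y2 - y0 * x2) * (x1 * y3 - y1 * x3)) /
      ((x1 * y2 - y1 * x2) * (x0 * y3 - y0 * x3)),
      ![(x1 * y2 - y1 * x2) • θ 0, (-(x0 * y2 - y0 * x2)) • θ 1, (x0 * y1 - y0 * x1) • θ 2,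
        ((x0 * y2 - y0 * x2) * (x0 * y1 - y0 * x1) / (x0 * y3 - y0 * x3)) • θ 3], ?_, ?_, ?_⟩
    · intro i
      fin_cases i
      · exact hsm 0 _ d12
      · exact hsm 1 _ (neg_ne_zero.mpr d02)
      · exact hsm 2 _ d01
      · exact hsm 3 _ (div_ne_zero (mul_ne_zero d02 d01) d03)
    · ext
      · change (x1 * y2 - y1 * x2) * x0 + (-(x0 * y2 - y0 * x2)) * x1
          + (x0 * y1 - y0 * x1) * x2 = 0
        ring
      · change (x1 * y2 - y1 * x2) * y0 + (-(x0 * y2 - y0 * x2)) * y1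
          + (x0 * y1 - y0 * x1) * y2 = 0
        ring
    · ext
      · change ((x0 * y2 - y0 * x2) * (x1 * y3 - y1 * x3)) /
          ((x1 * y2 - y1 * x2) * (x0 * y3 - y0 * x3)) * ((x1 * y2 - y1 * x2) * x0)
          + (-(x0 * y2 - y0 * x2)) * x1
          + ((x0 * y2 - y0 * x2) * (x0 * y1 - y0 * x1) / (x0 * y3 - y0 * x3)) * x3 = 0
        rw [mul_comm (x1 * y2 - y1 * x2) (x0 * y3 - y0 * x3), ← div_div, ← mul_assoc,
          div_mul_cancel₀ _ d12]
        rw [div_mul_eq_mul_div, div_mul_eq_mul_div, add_right_comm, ← add_div]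
        rw [div_add' _ _ _ d03, div_eq_zero_iff]
        left
        ring
      · change ((x0 * y2 - y0 * x2) * (x1 * y3 - y1 * x3)) /
          ((x1 * y2 - y1 * x2) * (x0 * y3 - y0 * x3)) * ((x1 * y2 - y1 * x2) * y0)
          + (-(x0 * y2 - y0 * x2)) * y1
          + ((x0 * y2 - y0 * x2) * (x0 * y1 - y0 * x1) / (x0 * y3 - y0 * x3)) * y3 = 0
        rw [mul_comm (x1 * y2 - y1 * x2) (x0 * y3 - y0 * x3), ← div_div, ← mul_assoc,
          div_mul_cancel₀ _ d12]
        rw [div_mul_eq_mul_div, div_mul_eq_mul_div, add_right_comm, ← add_div]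
        rw [div_add' _ _ _ d03, div_eq_zero_iff]
        left
        ring
  · -- both invariants equal the cross-ratio of the covectors `θ i`
    have cross : ∀ a, W.IsBasicInvariantAt q a →
        a * ((θ 1 (1, 0) * θ 2 (0, 1) - θ 1 (0, 1) * θ 2 (1, 0)) *
          (θ 0 (1, 0) * θ 3 (0, 1) - θ 0 (0, 1) * θ 3 (1, 0))) =
        (θ 0 (1, 0) * θ 2 (0, 1) - θ 0 (0, 1) * θ 2 (1, 0)) *
          (θ 1 (1, 0) * θ 3 (0, 1) - θ 1 (0, 1) * θ 3 (1, 0)) := by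
      rintro a ⟨η, hη, h1, h2⟩
      have prop : ∀ i, ∃ c : ℝ, c ≠ 0 ∧ η i = c • θ i := by
        intro i
        have hk : LinearMap.ker (θ i).toLinearMap ≤ LinearMap.ker (η i).toLinearMap := by
          rw [← (hθ i).2, ← (hη i).2]
        obtain ⟨v, hv⟩ : ∃ v, θ i v ≠ 0 := by
          by_contra! hc
          exact (hθ i).1 (ContinuousLinearMap.ext hc)
        have e : η i = (η i v / θ i v) • θ i := by
          refine ContinuousLinearMap.ext fun w => ?_
          have hw : w - (θ i w / θ i v) • v ∈ LinearMap.ker (θ i).toLinearMap := by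
            simp [hv]
          have := hk hw
          simp only [LinearMap.mem_ker, ContinuousLinearMap.coe_coe, map_sub, map_smul,
            smul_eq_mul, sub_eq_zero] at this
          rw [this]
          simp only [smul_apply, smul_eq_mul]
          ring
        refine ⟨_, ?_, e⟩
        intro h0
        rw [h0, zero_smul] at e
        exact (hη i).1 e
      choose c hc e using prop
      rw [e 0, e 1, e 2] at h1
      rw [e 0, e 1, e 3] at h2
      have p1 := congrArg (fun γ : Plane →L[ℝ] ℝ => γ (1, 0)) h1
      have p2 := congrArg (fun γ : Plane →L[ℝ] ℝ => γ (0, 1)) h1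
      have p3 := congrArg (fun γ : Plane →L[ℝ] ℝ => γ (1, 0)) h2
      have p4 := congrArg (fun γ : Plane →L[ℝ] ℝ => γ (0, 1)) h2
      simp only [add_apply, smul_apply, smul_eq_mul,
        zero_apply] at p1 p2 p3 p4
      -- wedge the first relation with `θ 2` and the second with `θ 3`
      have r1 : c 0 * (θ 0 (1, 0) * θ 2 (0, 1) - θ 0 (0, 1) * θ 2 (1, 0)) =
          - c 1 * (θ 1 (1, 0) * θ 2 (0, 1) - θ 1 (0, 1) * θ 2 (1, 0)) := by
        linear_combination θ 2 (0, 1) * p1 - θ 2 (1, 0) * p2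
      have r2 : a * c 0 * (θ 0 (1, 0) * θ 3 (0, 1) - θ 0 (0, 1) * θ 3 (1, 0)) =
          - c 1 * (θ 1 (1, 0) * θ 3 (0, 1) - θ 1 (0, 1) * θ 3 (1, 0)) := by
        linear_combination θ 3 (0, 1) * p3 - θ 3 (1, 0) * p4
      apply mul_left_cancel₀ (hc 0)
      linear_combination (θ 1 (1, 0) * θ 2 (0, 1) - θ 1 (0, 1) * θ 2 (1, 0)) * r2
        - (θ 1 (1, 0) * θ 3 (0, 1) - θ 1 (0, 1) * θ 3 (1, 0)) * r1
    intro a b ha hb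
    exact mul_right_cancel₀ (mul_ne_zero (D 1 2 (by decide)) (D 0 3 (by decide)))
      ((cross a ha).trans (cross b hb).symm)

/-- On the domain of the web, `basicInvariant` is the number given by the normalization. -/
theorem isBasicInvariantAt_iff (W : PlanarWeb 4 U) {q : Plane} (hq : q ∈ U) (a : ℝ) :
    W.IsBasicInvariantAt q a ↔ W.basicInvariant q = a := by
  have hu := W.existsUnique_isBasicInvariantAt hq
  have hs : W.IsBasicInvariantAt q (W.basicInvariant q) := by
    unfold basicInvariant
    rw [dif_pos hu.exists]
    exact hu.exists.choose_spec
  exact ⟨fun h => hu.unique hs h, fun h => h ▸ hs⟩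

end PlanarWeb

/-! A web of parallel lines is linear. For the converse, a linearizing diffeomorphism carries the
constant invariants along, so the web may be taken linear. Normalize forms so that the first three
foliations are the kernels of `ω`, `ω'` and `ω + ω'`. Constancy of the invariants makes every
foliation the kernel of `sω + tω'` with constants `s`, `t`. Let `∇` be the flat derivative of the
plane. Straightness of the leaves of `ker η` means `(∇_v η)(v) = 0` for the kernel field `v` of `η`.
For `η = sω + tω'` with constant `s`, `t` this is a binary cubic in `(s, t)` (`kerDeriv_comb`). Four
foliations give four distinct roots, so the cubic vanishes identically (`cubic_form_eq_zero`) and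
the whole pencil is straight. Its four coefficients are exactly the conditions for 1-forms `μ`, `σ`
with `∂ₐ ωᵦ = μₐ ωᵦ + σᵦ ωₐ`, and the same for `ω'` (`exists_isProjParallel`). Commuting second
derivatives then forces `dμ = dσ = 0` (`IsProjParallel.closed`). Skew-symmetrizing the system gives
`dω = (μ - σ) ∧ ω`, so with `dl = μ - σ` both `e^{-l} ω` and `e^{-l} ω'` are differentials. Their
primitives are coordinates in which every `ker (sω + tω')` is a family of parallel lines. -/

/-- The derivative of a real function on the plane in the direction `v`. -/
noncomputable def pd (v : Plane) (f : Plane → ℝ) (q : Plane) : ℝ := fderiv ℝ f q v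

/-! ### Partial derivatives on open sets and the Poincaré lemma. -/

section PartialDerivatives

variable {B : Set Plane} {f g : Plane → ℝ} {q : Plane}

theorem pd_contDiffOn (hB : IsOpen B) (v : Plane) (hf : ContDiffOn ℝ ∞ f B) :
    ContDiffOn ℝ ∞ (pd v f) B :=
  (((contDiffOn_infty_iff_fderiv_of_isOpen hB).1 hf).2).clm_apply contDiffOn_const

theorem ContDiffOn.differentiableAt_of_isOpen (hB : IsOpen B) (hf : ContDiffOn ℝ ∞ f B)
    (hq : q ∈ B) : DifferentiableAt ℝ f q :=
  (hf.contDiffAt (hB.mem_nhds hq)).differentiableAt (by simp)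

theorem pd_congr (hB : IsOpen B) (v : Plane) (h : ∀ q ∈ B, f q = g q) (hq : q ∈ B) :
    pd v f q = pd v g q := by
  have : f =ᶠ[nhds q] g := Filter.eventually_of_mem (hB.mem_nhds hq) h
  rw [pd, this.fderiv_eq, pd]

theorem pd_add (v : Plane) (hf : DifferentiableAt ℝ f q) (hg : DifferentiableAt ℝ g q) :
    pd v (fun x => f x + g x) q = pd v f q + pd v g q := by
  simp [pd, fderiv_fun_add hf hg]

theorem pd_sub (v : Plane) (hf : DifferentiableAt ℝ f q) (hg : DifferentiableAt ℝ g q) :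
    pd v (fun x => f x - g x) q = pd v f q - pd v g q := by
  simp [pd, fderiv_fun_sub hf hg]

theorem pd_mul (v : Plane) (hf : DifferentiableAt ℝ f q) (hg : DifferentiableAt ℝ g q) :
    pd v (fun x => f x * g x) q = pd v f q * g q + f q * pd v g q := by
  simp [pd, fderiv_fun_mul hf hg]
  ring

theorem pd_const_mul (v : Plane) (c : ℝ) (hf : DifferentiableAt ℝ f q) :
    pd v (fun x => c * f x) q = c * pd v f q := by
  simp [pd, fderiv_const_mul hf]

theorem pd_exp_neg (v : Plane) (hf : DifferentiableAt ℝ f q) :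
    pd v (fun x => Real.exp (-f x)) q = -(Real.exp (-f q) * pd v f q) := by
  have : fderiv ℝ (fun x => Real.exp (-f x)) q = _ := hf.hasFDerivAt.neg.exp.fderiv
  rw [pd, this]
  simp [pd]

theorem pd_comm (hB : IsOpen B) (u v : Plane) (hf : ContDiffOn ℝ ∞ f B) (hq : q ∈ B) :
    pd u (pd v f) q = pd v (pd u f) q := by
  have hc := hf.contDiffAt (hB.mem_nhds hq)
  have hs : IsSymmSndFDerivAt ℝ f q := hc.isSymmSndFDerivAt (by
    simpa using (WithTop.coe_le_coe.2 le_top : ((2 : ℕ∞) : ℕ∞ω) ≤ ∞))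
  have hd : DifferentiableAt ℝ (fderiv ℝ f) q :=
    ((((contDiffOn_infty_iff_fderiv_of_isOpen hB).1 hf).2).contDiffAt
      (hB.mem_nhds hq)).differentiableAt (by simp)
  have key : ∀ a b : Plane, pd a (pd b f) q = fderiv ℝ (fderiv ℝ f) q a b := by
    intro a b
    have := (hd.hasFDerivAt.clm_apply (hasFDerivAt_const b q)).fderiv
    change fderiv ℝ (fun x => fderiv ℝ f x b) q a = _
    rw [this]
    simp
  rw [key, key]
  exact hs u v

theorem fderiv_apply_eq_pd (f : Plane → ℝ) (q v : Plane) :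
    fderiv ℝ f q v = v.1 * pd (1, 0) f q + v.2 * pd (0, 1) f q := by
  have hv : v = v.1 • ((1, 0) : Plane) + v.2 • ((0, 1) : Plane) := by ext <;> simp
  conv_lhs => rw [hv]
  rw [map_add, map_smul, map_smul, pd, pd, smul_eq_mul, smul_eq_mul]

/-- The covector with components `a` and `b`. -/
noncomputable def covec (a b : ℝ) : Plane →L[ℝ] ℝ :=
  a • ContinuousLinearMap.fst ℝ ℝ ℝ + b • ContinuousLinearMap.snd ℝ ℝ ℝ

@[simp] theorem covec_apply (a b : ℝ) (v : Plane) : covec a b v = a * v.1 + b * v.2 := by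
  simp [covec]

/-- Poincaré lemma on a convex set: the mixed-partials hypothesis is the symmetry of the derivative
of the covector field `f dx + g dy`. -/
theorem exists_primitive (hB : IsOpen B) (hc : Convex ℝ B) (hf : ContDiffOn ℝ ∞ f B)
    (hg : ContDiffOn ℝ ∞ g B) (h : ∀ q ∈ B, pd (0, 1) f q = pd (1, 0) g q) :
    ∃ x : Plane → ℝ, ContDiffOn ℝ ∞ x B ∧
      ∀ q ∈ B, pd (1, 0) x q = f q ∧ pd (0, 1) x q = g q := by
  set θ : Plane → (Plane →L[ℝ] ℝ) := fun q => covec (f q) (g q) with hθ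
  have hsm : ContDiffOn ℝ ∞ θ B :=
    (hf.smul contDiffOn_const).add (hg.smul contDiffOn_const)
  have happ : ∀ q ∈ B, ∀ u v : Plane,
      fderiv ℝ θ q u v = pd u f q * v.1 + pd u g q * v.2 := by
    intro q hq u v
    have hf' := (hf.differentiableAt_of_isOpen hB hq).hasFDerivAt
    have hg' := (hg.differentiableAt_of_isOpen hB hq).hasFDerivAt
    have := (hf'.smul_const (ContinuousLinearMap.fst ℝ ℝ ℝ)).add
      (hg'.smul_const (ContinuousLinearMap.snd ℝ ℝ ℝ))
    have e : fderiv ℝ θ q = _ := this.fderiv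
    rw [e]
    simp [pd]
  obtain ⟨x, hx⟩ := hc.exists_forall_hasFDerivAt_of_fderiv_symmetric hB
    (hsm.differentiableOn (by simp)) (by
      intro q hq u v
      rw [happ q hq, happ q hq]
      simp only [pd]
      rw [fderiv_apply_eq_pd f q u, fderiv_apply_eq_pd f q v, fderiv_apply_eq_pd g q u,
        fderiv_apply_eq_pd g q v, h q hq]
      ring)
  refine ⟨x, ?_, ?_⟩
  · rw [contDiffOn_infty_iff_fderiv_of_isOpen hB]
    exact ⟨fun q hq => (hx q hq).differentiableAt.differentiableWithinAt,
      hsm.congr fun q hq => (hx q hq).fderiv⟩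
  · intro q hq
    simp [pd, (hx q hq).fderiv, hθ]

end PartialDerivatives

/-! ### Integrability of the system satisfied by a straight pencil. -/

/-- The system `∂ₐ ωᵦ = μₐ ωᵦ + σᵦ ωₐ` for the `1`-form `ω = p dx + q dy`: up to projective
equivalence with the flat connection, `ω` is parallel up to the factor `μ - σ`. -/
structure IsProjParallel (B : Set Plane) (μ₁ μ₂ σ₁ σ₂ p q : Plane → ℝ) : Prop where
  xp : ∀ z ∈ B, pd (1, 0) p z = (μ₁ z + σ₁ z) * p z
  yp : ∀ z ∈ B, pd (0, 1) p z = μ₂ z * p z + σ₁ z * q z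
  xq : ∀ z ∈ B, pd (1, 0) q z = μ₁ z * q z + σ₂ z * p z
  yq : ∀ z ∈ B, pd (0, 1) q z = (μ₂ z + σ₂ z) * q z

section Integrability

variable {B : Set Plane} {μ₁ μ₂ σ₁ σ₂ p q p' q' : Plane → ℝ}

/-- Equality of mixed partials of `p` and of `q`, with first derivatives eliminated by the system.
Each identity is linear in `(p, q)`, so two independent solutions will annihilate its coefficients.
-/
theorem IsProjParallel.compat (h : IsProjParallel B μ₁ μ₂ σ₁ σ₂ p q) (hB : IsOpen B)
    (hμ₁ : ContDiffOn ℝ ∞ μ₁ B) (hμ₂ : ContDiffOn ℝ ∞ μ₂ B)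
    (hσ₁ : ContDiffOn ℝ ∞ σ₁ B) (hσ₂ : ContDiffOn ℝ ∞ σ₂ B)
    (hp : ContDiffOn ℝ ∞ p B) (hq : ContDiffOn ℝ ∞ q B) {z : Plane} (hz : z ∈ B) :
    p z * (pd (0, 1) σ₁ z - (pd (1, 0) μ₂ z - pd (0, 1) μ₁ z) - σ₁ z * σ₂ z)
        + q z * (σ₁ z ^ 2 - pd (1, 0) σ₁ z) = 0 ∧
      q z * (pd (1, 0) σ₂ z + (pd (1, 0) μ₂ z - pd (0, 1) μ₁ z) - σ₁ z * σ₂ z)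
        + p z * (σ₂ z ^ 2 - pd (0, 1) σ₂ z) = 0 := by
  have dμ₁ := hμ₁.differentiableAt_of_isOpen hB hz
  have dμ₂ := hμ₂.differentiableAt_of_isOpen hB hz
  have dσ₁ := hσ₁.differentiableAt_of_isOpen hB hz
  have dσ₂ := hσ₂.differentiableAt_of_isOpen hB hz
  have dp := hp.differentiableAt_of_isOpen hB hz
  have dq := hq.differentiableAt_of_isOpen hB hz
  have e1 := pd_comm hB (0, 1) (1, 0) hp hz
  have e2 := pd_comm hB (0, 1) (1, 0) hq hz
  rw [pd_congr hB _ h.xp hz, pd_congr hB _ h.yp hz, pd_mul _ (dμ₁.fun_add dσ₁) dp,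
    pd_add _ dμ₁ dσ₁, pd_add _ (dμ₂.fun_mul dp) (dσ₁.fun_mul dq), pd_mul _ dμ₂ dp, pd_mul _ dσ₁ dq,
    h.xp z hz, h.yp z hz, h.xq z hz] at e1
  rw [pd_congr hB _ h.xq hz, pd_congr hB _ h.yq hz, pd_mul _ (dμ₂.fun_add dσ₂) dq,
    pd_add _ dμ₂ dσ₂, pd_add _ (dμ₁.fun_mul dq) (dσ₂.fun_mul dp), pd_mul _ dμ₁ dq, pd_mul _ dσ₂ dp,
    h.xq z hz, h.yp z hz, h.yq z hz] at e2
  constructor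
  · linear_combination e1
  · linear_combination -e2

theorem eq_zero_of_two_relations {a b c d x y : ℝ} (hdet : a * d - b * c ≠ 0)
    (h₁ : a * x + b * y = 0) (h₂ : c * x + d * y = 0) : x = 0 ∧ y = 0 := by
  constructor <;> apply (mul_eq_zero_iff_left hdet).1
  · linear_combination d * h₁ - b * h₂
  · linear_combination a * h₂ - c * h₁

/-- If two independent `1`-forms solve the system, then `μ` and `σ` are closed. -/
theorem IsProjParallel.closed (h : IsProjParallel B μ₁ μ₂ σ₁ σ₂ p q)
    (h' : IsProjParallel B μ₁ μ₂ σ₁ σ₂ p' q') (hB : IsOpen B)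
    (hμ₁ : ContDiffOn ℝ ∞ μ₁ B) (hμ₂ : ContDiffOn ℝ ∞ μ₂ B)
    (hσ₁ : ContDiffOn ℝ ∞ σ₁ B) (hσ₂ : ContDiffOn ℝ ∞ σ₂ B)
    (hp : ContDiffOn ℝ ∞ p B) (hq : ContDiffOn ℝ ∞ q B)
    (hp' : ContDiffOn ℝ ∞ p' B) (hq' : ContDiffOn ℝ ∞ q' B)
    (hdet : ∀ z ∈ B, p z * q' z - q z * p' z ≠ 0) {z : Plane} (hz : z ∈ B) :
    pd (0, 1) μ₁ z = pd (1, 0) μ₂ z ∧ pd (0, 1) σ₁ z = pd (1, 0) σ₂ z := by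
  -- The coefficient of `dμ`, the only obstruction that has to be shown to vanish.
  set m : Plane → ℝ := fun z => pd (1, 0) μ₂ z - pd (0, 1) μ₁ z with hm
  have hms : ContDiffOn ℝ ∞ m B := (pd_contDiffOn hB _ hμ₂).sub (pd_contDiffOn hB _ hμ₁)
  -- Both solutions satisfy the relations of `compat` with the same coefficients, which therefore
  -- vanish: `∇σ` is `σ ⊗ σ` plus a skew part given by `m`.
  have key : ∀ z ∈ B, pd (1, 0) σ₁ z = σ₁ z * σ₁ z ∧ pd (0, 1) σ₁ z = σ₁ z * σ₂ z + m z ∧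
      pd (1, 0) σ₂ z = σ₁ z * σ₂ z - m z ∧ pd (0, 1) σ₂ z = σ₂ z * σ₂ z := by
    intro z hz
    have c := h.compat hB hμ₁ hμ₂ hσ₁ hσ₂ hp hq hz
    have c' := h'.compat hB hμ₁ hμ₂ hσ₁ hσ₂ hp' hq' hz
    have r := eq_zero_of_two_relations (hdet z hz) c.1 c'.1
    have r' := eq_zero_of_two_relations
      (show q z * p' z - p z * q' z ≠ 0 from fun h0 => hdet z hz (by linear_combination -h0))
      c.2 c'.2
    refine ⟨?_, ?_, ?_, ?_⟩
    · linear_combination -r.2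
    · linear_combination r.1
    · linear_combination r'.1
    · linear_combination -r'.2
  have k1 := fun z hz => (key z hz).1
  have k2 := fun z hz => (key z hz).2.1
  have k3 := fun z hz => (key z hz).2.2.1
  have k4 := fun z hz => (key z hz).2.2.2
  -- Equality of mixed partials of `σ₁` and `σ₂` yields `dm = 3mσ`.
  have hmd : ∀ z ∈ B, pd (1, 0) m z = 3 * (σ₁ z * m z) ∧ pd (0, 1) m z = 3 * (σ₂ z * m z) := by
    intro z hz
    have dσ₁ := hσ₁.differentiableAt_of_isOpen hB hz
    have dσ₂ := hσ₂.differentiableAt_of_isOpen hB hz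
    have dm := hms.differentiableAt_of_isOpen hB hz
    have e1 := pd_comm hB (0, 1) (1, 0) hσ₁ hz
    have e2 := pd_comm hB (0, 1) (1, 0) hσ₂ hz
    rw [pd_congr hB _ k1 hz, pd_congr hB _ k2 hz, pd_mul _ dσ₁ dσ₁, pd_add _ (dσ₁.fun_mul dσ₂) dm,
      pd_mul _ dσ₁ dσ₂, k1 z hz, k2 z hz, k3 z hz] at e1
    rw [pd_congr hB _ k3 hz, pd_congr hB _ k4 hz, pd_mul _ dσ₂ dσ₂, pd_sub _ (dσ₁.fun_mul dσ₂) dm,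
      pd_mul _ dσ₁ dσ₂, k3 z hz, k2 z hz, k4 z hz] at e2
    constructor
    · linear_combination -e1
    · linear_combination -e2
  -- Applying `d` again, `0 = d(mσ) = dm ∧ σ + m dσ`. The first term is `3m σ ∧ σ = 0`, and `dσ` has
  -- coefficient `-2m`, so `m² = 0`.
  have hm0 : m z = 0 := by
    have dσ₁ := hσ₁.differentiableAt_of_isOpen hB hz
    have dσ₂ := hσ₂.differentiableAt_of_isOpen hB hz
    have dm := hms.differentiableAt_of_isOpen hB hz
    have e := pd_comm hB (0, 1) (1, 0) hms hz
    rw [pd_congr hB _ (fun z hz => (hmd z hz).1) hz, pd_congr hB _ (fun z hz => (hmd z hz).2) hz,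
      pd_const_mul _ _ (dσ₁.fun_mul dm), pd_const_mul _ _ (dσ₂.fun_mul dm), pd_mul _ dσ₁ dm,
      pd_mul _ dσ₂ dm, k2 z hz, k3 z hz, (hmd z hz).1, (hmd z hz).2] at e
    have : m z * m z = 0 := by linear_combination e / 6
    simpa using this
  constructor
  · linear_combination -hm0
  · linear_combination k2 z hz - k3 z hz + 2 * hm0

/-- Two independent solutions of the system are, up to a common factor, differentials. -/
theorem IsProjParallel.exists_coordinates (h : IsProjParallel B μ₁ μ₂ σ₁ σ₂ p q)
    (h' : IsProjParallel B μ₁ μ₂ σ₁ σ₂ p' q') (hB : IsOpen B) (hc : Convex ℝ B)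
    (hμ₁ : ContDiffOn ℝ ∞ μ₁ B) (hμ₂ : ContDiffOn ℝ ∞ μ₂ B)
    (hσ₁ : ContDiffOn ℝ ∞ σ₁ B) (hσ₂ : ContDiffOn ℝ ∞ σ₂ B)
    (hp : ContDiffOn ℝ ∞ p B) (hq : ContDiffOn ℝ ∞ q B)
    (hp' : ContDiffOn ℝ ∞ p' B) (hq' : ContDiffOn ℝ ∞ q' B)
    (hdet : ∀ z ∈ B, p z * q' z - q z * p' z ≠ 0) :
    ∃ x x' ρ : Plane → ℝ, ContDiffOn ℝ ∞ x B ∧ ContDiffOn ℝ ∞ x' B ∧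
      ∀ z ∈ B, ρ z ≠ 0 ∧ pd (1, 0) x z = ρ z * p z ∧ pd (0, 1) x z = ρ z * q z ∧
        pd (1, 0) x' z = ρ z * p' z ∧ pd (0, 1) x' z = ρ z * q' z := by
  have hcl := fun z (hz : z ∈ B) =>
    h.closed h' hB hμ₁ hμ₂ hσ₁ hσ₂ hp hq hp' hq' hdet hz
  -- Since `dω = (μ - σ) ∧ ω` for every solution, one integrating factor `e^{-l}` serves both forms.
  obtain ⟨l, hl, hl'⟩ := exists_primitive hB hc (hμ₁.sub hσ₁) (hμ₂.sub hσ₂) (by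
    intro z hz
    rw [pd_sub _ (hμ₁.differentiableAt_of_isOpen hB hz) (hσ₁.differentiableAt_of_isOpen hB hz),
      pd_sub _ (hμ₂.differentiableAt_of_isOpen hB hz) (hσ₂.differentiableAt_of_isOpen hB hz),
      (hcl z hz).1, (hcl z hz).2])
  have hρ : ContDiffOn ℝ ∞ (fun z => Real.exp (-l z)) B := hl.neg.exp
  have primitive : ∀ p q : Plane → ℝ, IsProjParallel B μ₁ μ₂ σ₁ σ₂ p q →
      ContDiffOn ℝ ∞ p B → ContDiffOn ℝ ∞ q B → ∃ x : Plane → ℝ, ContDiffOn ℝ ∞ x B ∧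
        ∀ z ∈ B, pd (1, 0) x z = Real.exp (-l z) * p z ∧
          pd (0, 1) x z = Real.exp (-l z) * q z := by
    intro p q h hp hq
    refine exists_primitive hB hc (hρ.mul hp) (hρ.mul hq) fun z hz => ?_
    have dl := hl.differentiableAt_of_isOpen hB hz
    have dρ := hρ.differentiableAt_of_isOpen hB hz
    rw [pd_mul _ dρ (hp.differentiableAt_of_isOpen hB hz),
      pd_mul _ dρ (hq.differentiableAt_of_isOpen hB hz), pd_exp_neg _ dl, pd_exp_neg _ dl,
      (hl' z hz).1, (hl' z hz).2, h.yp z hz, h.xq z hz]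
    ring
  obtain ⟨x, hx, hx'⟩ := primitive p q h hp hq
  obtain ⟨y, hy, hy'⟩ := primitive p' q' h' hp' hq'
  exact ⟨x, y, fun z => Real.exp (-l z), hx, hy, fun z hz =>
    ⟨(Real.exp_pos _).ne', (hx' z hz).1, (hx' z hz).2, (hy' z hz).1, (hy' z hz).2⟩⟩

end Integrability

/-! ### Straight leaves and the cubic form of a pencil. -/

section Geodesic

/-- For `1`-forms `ω = p dx + q dy`, `ω' = p' dx + q' dy`, `ω'' = p'' dx + q'' dy`, the derivative
of `ω` along the kernel field of `ω'`, evaluated on the kernel field of `ω''`. -/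
noncomputable def kerDeriv (p q p' q' p'' q'' : Plane → ℝ) (z : Plane) : ℝ :=
  (-q' z * pd (1, 0) p z + p' z * pd (0, 1) p z) * -q'' z +
    (-q' z * pd (1, 0) q z + p' z * pd (0, 1) q z) * p'' z

variable {B : Set Plane} {p q p' q' p'' q'' : Plane → ℝ}

theorem kerDeriv_contDiffOn (hB : IsOpen B) (hp : ContDiffOn ℝ ∞ p B) (hq : ContDiffOn ℝ ∞ q B)
    (hp' : ContDiffOn ℝ ∞ p' B) (hq' : ContDiffOn ℝ ∞ q' B) (hp'' : ContDiffOn ℝ ∞ p'' B)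
    (hq'' : ContDiffOn ℝ ∞ q'' B) : ContDiffOn ℝ ∞ (kerDeriv p q p' q' p'' q'') B :=
  (((hq'.neg.mul (pd_contDiffOn hB _ hp)).add (hp'.mul (pd_contDiffOn hB _ hp))).mul hq''.neg).add
    (((hq'.neg.mul (pd_contDiffOn hB _ hq)).add (hp'.mul (pd_contDiffOn hB _ hq))).mul hp'')

/-- A bilinear form on the plane that vanishes on the vectors of a basis is zero. -/
theorem bilin_eq_zero_of_basis {a b c d x y x' y' : ℝ} (hdet : x * y' - y * x' ≠ 0)
    (h00 : (x * a + y * b) * x + (x * c + y * d) * y = 0)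
    (h01 : (x * a + y * b) * x' + (x * c + y * d) * y' = 0)
    (h10 : (x' * a + y' * b) * x + (x' * c + y' * d) * y = 0)
    (h11 : (x' * a + y' * b) * x' + (x' * c + y' * d) * y' = 0) :
    a = 0 ∧ b = 0 ∧ c = 0 ∧ d = 0 := by
  have r := eq_zero_of_two_relations (x := x * a + y * b) (y := x * c + y * d) hdet
    (by linear_combination h00) (by linear_combination h01)
  have r' := eq_zero_of_two_relations (x := x' * a + y' * b) (y := x' * c + y' * d) hdet
    (by linear_combination h10) (by linear_combination h11)
  have s := eq_zero_of_two_relations hdet r.1 r'.1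
  have s' := eq_zero_of_two_relations hdet r.2 r'.2
  exact ⟨s.1, s.2, s'.1, s'.2⟩

/-- If the kernels of all forms in the pencil spanned by two independent `1`-forms are tangent to
straight lines, then the two forms solve a system `∂ₐ ωᵦ = μₐ ωᵦ + σᵦ ωₐ`. -/
theorem exists_isProjParallel (hB : IsOpen B) (hp : ContDiffOn ℝ ∞ p B)
    (hq : ContDiffOn ℝ ∞ q B) (hp' : ContDiffOn ℝ ∞ p' B) (hq' : ContDiffOn ℝ ∞ q' B)
    (hdet : ∀ z ∈ B, p z * q' z - q z * p' z ≠ 0)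
    (h30 : ∀ z ∈ B, kerDeriv p q p q p q z = 0)
    (h21 : ∀ z ∈ B, kerDeriv p' q' p q p q z + kerDeriv p q p q p' q' z
      + kerDeriv p q p' q' p q z = 0)
    (h12 : ∀ z ∈ B, kerDeriv p q p' q' p' q' z + kerDeriv p' q' p q p' q' z
      + kerDeriv p' q' p' q' p q z = 0)
    (h03 : ∀ z ∈ B, kerDeriv p' q' p' q' p' q' z = 0) :
    ∃ μ₁ μ₂ σ₁ σ₂ : Plane → ℝ, ContDiffOn ℝ ∞ μ₁ B ∧ ContDiffOn ℝ ∞ μ₂ B ∧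
      ContDiffOn ℝ ∞ σ₁ B ∧ ContDiffOn ℝ ∞ σ₂ B ∧
      IsProjParallel B μ₁ μ₂ σ₁ σ₂ p q ∧ IsProjParallel B μ₁ μ₂ σ₁ σ₂ p' q' := by
  have hD : ContDiffOn ℝ ∞ (fun z => (p z * q' z - q z * p' z) ^ 2) B :=
    ((hp.mul hq').sub (hq.mul hp')).pow 2
  have hD0 : ∀ z ∈ B, (p z * q' z - q z * p' z) ^ 2 ≠ 0 := fun z hz => pow_ne_zero 2 (hdet z hz)
  have sm : ∀ f g r s : Plane → ℝ, ContDiffOn ℝ ∞ f B → ContDiffOn ℝ ∞ g B →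
      ContDiffOn ℝ ∞ r B → ContDiffOn ℝ ∞ s B →
      ContDiffOn ℝ ∞ (fun z => (-f z * r z - g z * s z) / (p z * q' z - q z * p' z) ^ 2) B :=
    fun f g r s hf hg hr hs => ((hf.neg.mul hr).sub (hg.mul hs)).div hD hD0
  have c1 := kerDeriv_contDiffOn hB hp' hq' hp' hq' hp hq
  have c2 := kerDeriv_contDiffOn hB hp hq hp hq hp' hq'
  have c3 := kerDeriv_contDiffOn hB hp' hq' hp hq hp' hq'
  have c4 := kerDeriv_contDiffOn hB hp hq hp' hq' hp hq
  -- With `v = (-q, p)`, `v' = (-q', p')` and `δ = qp' - pq'`, one has `ω(v) = ω'(v') = 0`, `ω(v') =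
  -- δ`, `ω'(v) = -δ`. The system then prescribes `μ(v) = (∇_v ω)(v')/δ`, `μ(v') = -(∇_{v'}
  -- ω')(v)/δ`, `σ(v) = (∇_{v'} ω)(v)/δ`, `σ(v') = -(∇_v ω')(v')/δ`. The witnesses solve these
  -- equations by Cramer's rule.
  refine ⟨_, _, _, _, sm _ _ _ _ c1 c2 hp hp', sm _ _ _ _ c1 c2 hq hq', sm _ _ _ _ c3 c4 hp hp',
    sm _ _ _ _ c3 c4 hq hq', ?_⟩
  have solve : ∀ z ∈ B, ∀ f g : ℝ,
      -q z * ((-f * p z - g * p' z) / (p z * q' z - q z * p' z) ^ 2) +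
        p z * ((-f * q z - g * q' z) / (p z * q' z - q z * p' z) ^ 2) =
        g / (q z * p' z - p z * q' z) ∧
      -q' z * ((-f * p z - g * p' z) / (p z * q' z - q z * p' z) ^ 2) +
        p' z * ((-f * q z - g * q' z) / (p z * q' z - q z * p' z) ^ 2) =
        -f / (q z * p' z - p z * q' z) := by
    intro z hz f g
    have h1 := hdet z hz
    have h2 : q z * p' z - p z * q' z ≠ 0 := fun h => h1 (by linear_combination -h)
    constructor
    · rw [eq_div_iff h2, ← mul_div_assoc, ← mul_div_assoc, ← add_div, div_mul_eq_mul_div,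
        div_eq_iff (hD0 z hz)]
      ring
    · rw [eq_div_iff h2, ← mul_div_assoc, ← mul_div_assoc, ← add_div, div_mul_eq_mul_div,
        div_eq_iff (hD0 z hz)]
      ring
  have main : ∀ z ∈ B, ∀ μ₁ μ₂ σ₁ σ₂ : ℝ,
      (-q z * μ₁ + p z * μ₂ = kerDeriv p q p q p' q' z / (q z * p' z - p z * q' z) ∧
        -q' z * μ₁ + p' z * μ₂ = -kerDeriv p' q' p' q' p q z / (q z * p' z - p z * q' z)) →
      (-q z * σ₁ + p z * σ₂ = kerDeriv p q p' q' p q z / (q z * p' z - p z * q' z) ∧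
        -q' z * σ₁ + p' z * σ₂ = -kerDeriv p' q' p q p' q' z / (q z * p' z - p z * q' z)) →
      (pd (1, 0) p z = (μ₁ + σ₁) * p z ∧ pd (0, 1) p z = μ₂ * p z + σ₁ * q z ∧
        pd (1, 0) q z = μ₁ * q z + σ₂ * p z ∧ pd (0, 1) q z = (μ₂ + σ₂) * q z) ∧
      (pd (1, 0) p' z = (μ₁ + σ₁) * p' z ∧ pd (0, 1) p' z = μ₂ * p' z + σ₁ * q' z ∧
        pd (1, 0) q' z = μ₁ * q' z + σ₂ * p' z ∧ pd (0, 1) q' z = (μ₂ + σ₂) * q' z) := by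
    rintro z hz μ₁ μ₂ σ₁ σ₂ ⟨m0, m1⟩ ⟨s0, s1⟩
    have h1 := hdet z hz
    have h2 : q z * p' z - p z * q' z ≠ 0 := fun h => h1 (by linear_combination -h)
    rw [eq_div_iff h2] at m0 m1 s0 s1
    have h30 := h30 z hz
    have h21 := h21 z hz
    have h12 := h12 z hz
    have h03 := h03 z hz
    simp only [kerDeriv] at m0 m1 s0 s1 h30 h21 h12 h03
    have hv : -q z * p' z - p z * -q' z ≠ 0 := fun h => h1 (by linear_combination h)
    -- Eight values on the basis `v`, `v'` must agree: four do by the choice of `μ` and `σ`, the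
    -- other four by the vanishing of the coefficients of the cubic.
    have A := bilin_eq_zero_of_basis (a := pd (1, 0) p z - (μ₁ + σ₁) * p z)
      (b := pd (0, 1) p z - (μ₂ * p z + σ₁ * q z)) (c := pd (1, 0) q z - (μ₁ * q z + σ₂ * p z))
      (d := pd (0, 1) q z - (μ₂ + σ₂) * q z) hv (by linear_combination h30)
      (by linear_combination -m0) (by linear_combination -s0)
      (by linear_combination h12 - m1 - s1)
    have A' := bilin_eq_zero_of_basis (a := pd (1, 0) p' z - (μ₁ + σ₁) * p' z)
      (b := pd (0, 1) p' z - (μ₂ * p' z + σ₁ * q' z))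
      (c := pd (1, 0) q' z - (μ₁ * q' z + σ₂ * p' z))
      (d := pd (0, 1) q' z - (μ₂ + σ₂) * q' z) hv (by linear_combination h21 + m0 + s0)
      (by linear_combination s1) (by linear_combination m1)
      (by linear_combination h03)
    simpa only [sub_eq_zero] using And.intro A A'
  have fin := fun z hz => main z hz _ _ _ _ (solve z hz _ _) (solve z hz _ _)
  exact ⟨⟨fun z hz => (fin z hz).1.1, fun z hz => (fin z hz).1.2.1,
    fun z hz => (fin z hz).1.2.2.1, fun z hz => (fin z hz).1.2.2.2⟩,
    ⟨fun z hz => (fin z hz).2.1, fun z hz => (fin z hz).2.2.1,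
    fun z hz => (fin z hz).2.2.2.1, fun z hz => (fin z hz).2.2.2.2⟩⟩

/-- The kernel field depends linearly on the form and `s`, `t` are constants, so `kerDeriv` is
trilinear here and no derivatives of coefficients appear. -/
theorem kerDeriv_comb {z : Plane} (hp : DifferentiableAt ℝ p z) (hq : DifferentiableAt ℝ q z)
    (hp' : DifferentiableAt ℝ p' z) (hq' : DifferentiableAt ℝ q' z) (s t : ℝ) :
    kerDeriv (fun z => s * p z + t * p' z) (fun z => s * q z + t * q' z)
      (fun z => s * p z + t * p' z) (fun z => s * q z + t * q' z)
      (fun z => s * p z + t * p' z) (fun z => s * q z + t * q' z) z =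
    s ^ 3 * kerDeriv p q p q p q z +
      s ^ 2 * t * (kerDeriv p' q' p q p q z + kerDeriv p q p q p' q' z
        + kerDeriv p q p' q' p q z) +
      s * t ^ 2 * (kerDeriv p q p' q' p' q' z + kerDeriv p' q' p q p' q' z
        + kerDeriv p' q' p' q' p q z) +
      t ^ 3 * kerDeriv p' q' p' q' p' q' z := by
  simp only [kerDeriv]
  rw [pd_add _ (hp.const_mul s) (hp'.const_mul t), pd_add _ (hq.const_mul s) (hq'.const_mul t),
    pd_add _ (hp.const_mul s) (hp'.const_mul t), pd_add _ (hq.const_mul s) (hq'.const_mul t),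
    pd_const_mul _ _ hp, pd_const_mul _ _ hq, pd_const_mul _ _ hp', pd_const_mul _ _ hq',
    pd_const_mul _ _ hp, pd_const_mul _ _ hq, pd_const_mul _ _ hp', pd_const_mul _ _ hq']
  ring

/-- A binary cubic form with four distinct roots vanishes. -/
theorem cubic_form_eq_zero {A B C D c : ℝ} (hc0 : c ≠ 0) (hc1 : c ≠ 1)
    (h : ∀ s t : ℝ, (s = 1 ∧ t = 0) ∨ (s = 0 ∧ t = 1) ∨ (s = 1 ∧ t = 1) ∨ (s = c ∧ t = 1) →
      s ^ 3 * A + s ^ 2 * t * B + s * t ^ 2 * C + t ^ 3 * D = 0) :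
    A = 0 ∧ B = 0 ∧ C = 0 ∧ D = 0 := by
  have h1 := h 1 0 (by simp)
  have h2 := h 0 1 (by simp)
  have h3 := h 1 1 (by simp)
  have h4 := h c 1 (by simp)
  have hA : A = 0 := by linear_combination h1
  have hD : D = 0 := by linear_combination h2
  have hB : c * (c - 1) * B = 0 := by
    linear_combination h4 - c * h3 - (c ^ 3 - c) * hA - (1 - c) * hD
  have hB' : B = 0 := by
    simpa [hc0, sub_ne_zero.2 hc1] using hB
  exact ⟨hA, hB', by linear_combination h3 - hA - hB' - hD, hD⟩

/-- A foliation by straight lines that is defined by `p dx + q dy`. -/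
theorem PlaneFoliation.IsStraight.kerDeriv_eq_zero {U : TopologicalSpace.Opens Plane}
    {F : PlaneFoliation U} (hF : F.IsStraight) (hB : IsOpen B) (hBU : B ⊆ U)
    (hp : ContDiffOn ℝ ∞ p B) (hq : ContDiffOn ℝ ∞ q B)
    (hdir : ∀ z ∈ B, F.dir z = LinearMap.ker (covec (p z) (q z)).toLinearMap)
    {z : Plane} (hz : z ∈ B) : kerDeriv p q p q p q z = 0 := by
  set v : Plane := (-q z, p z) with hv
  have hvz : v ∈ F.dir z := by
    rw [hdir z hz]
    simp [hv]
    ring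
  obtain ⟨ε, hε, hball⟩ := Metric.isOpen_iff.1 hB z hz
  have hline : HasDerivAt (fun t : ℝ => z + t • v) v 0 := by
    simpa using ((hasDerivAt_id (0 : ℝ)).smul_const v).const_add z
  have hz0 : z + (0 : ℝ) • v = z := by simp
  -- Along the line through `z` in direction `v` the form keeps annihilating the fixed vector `v`;
  -- the derivative of this identity at `t = 0` is the claim.
  have hev : ∀ᶠ t : ℝ in nhds 0, p (z + t • v) * v.1 + q (z + t • v) * v.2 = 0 := by
    have hcont : Filter.Tendsto (fun t : ℝ => z + t • v) (nhds 0) (nhds z) := by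
      simpa using hline.continuousAt.tendsto
    filter_upwards [hcont (Metric.ball_mem_nhds z hε)] with t ht
    have hseg : segment ℝ z (z + t • v) ⊆ Metric.ball z ε :=
      (convex_ball z ε).segment_subset (Metric.mem_ball_self hε) ht
    have hd := hF z (z + t • v) ((hseg.trans hball).trans hBU)
      (by simpa using (F.dir z).smul_mem t hvz)
    have hm : v ∈ F.dir (z + t • v) := hd ▸ hvz
    rw [hdir _ (hball ht)] at hm
    simpa using hm
  have hp' : HasFDerivAt p (fderiv ℝ p z) (z + (0 : ℝ) • v) := by
    rw [hz0]; exact (hp.differentiableAt_of_isOpen hB hz).hasFDerivAt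
  have hq' : HasFDerivAt q (fderiv ℝ q z) (z + (0 : ℝ) • v) := by
    rw [hz0]; exact (hq.differentiableAt_of_isOpen hB hz).hasFDerivAt
  have hd := ((hp'.comp_hasDerivAt (0 : ℝ) hline).mul_const v.1).add
    ((hq'.comp_hasDerivAt (0 : ℝ) hline).mul_const v.2)
  have h0 := hd.unique ((hasDerivAt_const (0 : ℝ) (0 : ℝ)).congr_of_eventuallyEq hev)
  rw [fderiv_apply_eq_pd, fderiv_apply_eq_pd] at h0
  simpa [kerDeriv, hv] using h0

end Geodesic

/-! ### Local coordinates from the inverse function theorem. -/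

section LocalDiffeo

/-- The linear automorphism of the plane with an invertible matrix. -/
noncomputable def planeEquiv (a b c d : ℝ) (h : a * d - b * c ≠ 0) : Plane ≃L[ℝ] Plane :=
  ContinuousLinearEquiv.equivOfInverse ((covec a b).prod (covec c d))
    ((covec (d / (a * d - b * c)) (-b / (a * d - b * c))).prod
      (covec (-c / (a * d - b * c)) (a / (a * d - b * c))))
    (by
      intro v
      ext
      · simp only [ContinuousLinearMap.prod_apply, covec_apply]
        rw [div_mul_eq_mul_div, div_mul_eq_mul_div, ← add_div, div_eq_iff h]
        ring
      · simp only [ContinuousLinearMap.prod_apply, covec_apply]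
        rw [div_mul_eq_mul_div, div_mul_eq_mul_div, ← add_div, div_eq_iff h]
        ring)
    (by
      intro v
      ext
      · simp only [ContinuousLinearMap.prod_apply, covec_apply]
        simp only [div_mul_eq_mul_div, ← add_div, mul_div_assoc']
        rw [div_eq_iff h]
        ring
      · simp only [ContinuousLinearMap.prod_apply, covec_apply]
        simp only [div_mul_eq_mul_div, ← add_div, mul_div_assoc']
        rw [div_eq_iff h]
        ring)

@[simp] theorem planeEquiv_apply (a b c d : ℝ) (h : a * d - b * c ≠ 0) (v : Plane) :
    planeEquiv a b c d h v = (a * v.1 + b * v.2, c * v.1 + d * v.2) := by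
  simp [planeEquiv]

variable {B : Set Plane} {x y : Plane → ℝ}

theorem hasFDerivAt_prodMk_planeEquiv (hB : IsOpen B) (hx : ContDiffOn ℝ ∞ x B)
    (hy : ContDiffOn ℝ ∞ y B) {z : Plane} (hz : z ∈ B)
    (hdet : pd (1, 0) x z * pd (0, 1) y z - pd (0, 1) x z * pd (1, 0) y z ≠ 0) :
    HasFDerivAt (fun z => (x z, y z))
      (planeEquiv _ _ _ _ hdet : Plane →L[ℝ] Plane) z := by
  have h := (hx.differentiableAt_of_isOpen hB hz).hasFDerivAt.prodMk
    (hy.differentiableAt_of_isOpen hB hz).hasFDerivAt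
  refine h.congr_fderiv ?_
  refine ContinuousLinearMap.ext fun v : Plane => ?_
  simp only [ContinuousLinearEquiv.coe_coe, planeEquiv_apply, ContinuousLinearMap.prod_apply]
  rw [fderiv_apply_eq_pd x, fderiv_apply_eq_pd y]
  ext <;> simp only <;> ring

/-- Two functions with independent differentials are local coordinates. -/
theorem exists_local_coordinates (hB : IsOpen B) (hx : ContDiffOn ℝ ∞ x B)
    (hy : ContDiffOn ℝ ∞ y B)
    (hdet : ∀ z ∈ B, pd (1, 0) x z * pd (0, 1) y z - pd (0, 1) x z * pd (1, 0) y z ≠ 0)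
    {z : Plane} (hz : z ∈ B) :
    ∃ φ : OpenPartialHomeomorph Plane Plane, z ∈ φ.source ∧ φ.source ⊆ B ∧
      (∀ w, φ w = (x w, y w)) ∧ ContDiffOn ℝ ∞ φ φ.source ∧
      ContDiffOn ℝ ∞ φ.symm φ.target := by
  have hsm : ContDiffOn ℝ ∞ (fun z => (x z, y z)) B := hx.prodMk hy
  have hc := hsm.contDiffAt (hB.mem_nhds hz)
  have hd := hasFDerivAt_prodMk_planeEquiv hB hx hy hz (hdet z hz)
  set ψ := hc.toOpenPartialHomeomorph (fun z => (x z, y z)) hd (by simp) with hψ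
  have hψz : z ∈ ψ.source := hc.mem_toOpenPartialHomeomorph_source hd (by simp)
  have hcoe : ∀ w, (ψ.restrOpen B hB) w = (x w, y w) := fun _ => rfl
  have hsrc : (ψ.restrOpen B hB).source ⊆ B := by
    rw [OpenPartialHomeomorph.restrOpen_source]
    exact Set.inter_subset_right
  have hfun : (ψ.restrOpen B hB : Plane → Plane) = fun z => (x z, y z) := funext hcoe
  refine ⟨ψ.restrOpen B hB, ?_, hsrc, hcoe, ?_, ?_⟩
  · rw [OpenPartialHomeomorph.restrOpen_source]
    exact ⟨hψz, hz⟩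
  · rw [hfun]
    exact hsm.mono hsrc
  -- Restricting to `B` keeps the Jacobian invertible on the whole source, so the inverse is smooth
  -- at every point of the target and not only at the image of `z`.
  · intro w hw
    have hw' := hsrc ((ψ.restrOpen B hB).map_target hw)
    refine ((ψ.restrOpen B hB).contDiffAt_symm (f₀' := planeEquiv _ _ _ _ (hdet _ hw')) hw ?_
      ?_).contDiffWithinAt
    · rw [hfun]
      exact hasFDerivAt_prodMk_planeEquiv hB hx hy hw' (hdet _ hw')
    · rw [hfun]
      exact hsm.contDiffAt (hB.mem_nhds hw')

end LocalDiffeo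

/-! ### Covectors with a common kernel. -/

section Covectors

theorem exists_eq_smul_of_ker_eq {α β : Plane →L[ℝ] ℝ} (hα : α ≠ 0)
    (h : LinearMap.ker α.toLinearMap = LinearMap.ker β.toLinearMap) : ∃ c : ℝ, β = c • α := by
  obtain ⟨v, hv⟩ : ∃ v, α v ≠ 0 := by
    by_contra! hc
    exact hα (ContinuousLinearMap.ext hc)
  refine ⟨β v / α v, ContinuousLinearMap.ext fun w => ?_⟩
  have hw : w - (α w / α v) • v ∈ LinearMap.ker β.toLinearMap := by
    rw [← h]
    simp [hv]
  simp only [LinearMap.mem_ker, ContinuousLinearMap.coe_coe, map_sub, map_smul,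
    smul_eq_mul, sub_eq_zero] at hw
  rw [hw, smul_apply, smul_eq_mul]
  ring

theorem clm_apply_eq (α : Plane →L[ℝ] ℝ) (v : Plane) :
    α v = v.1 * α (1, 0) + v.2 * α (0, 1) := by
  have hv : v = v.1 • ((1, 0) : Plane) + v.2 • ((0, 1) : Plane) := by ext <;> simp
  conv_lhs => rw [hv]
  rw [map_add, map_smul, map_smul, smul_eq_mul, smul_eq_mul]

theorem ker_eq_of_forall_mul_eq {α β : Plane →L[ℝ] ℝ} {k l : ℝ} (hk : k ≠ 0) (hl : l ≠ 0)
    (h : ∀ v, k * α v = l * β v) :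
    LinearMap.ker α.toLinearMap = LinearMap.ker β.toLinearMap := by
  ext v
  simp only [LinearMap.mem_ker, ContinuousLinearMap.coe_coe]
  have := h v
  constructor <;> intro h0 <;> simp [h0, hk, hl] at this <;> exact this

end Covectors

/-! ### Transport of webs and of the basic invariant by local diffeomorphisms. -/

namespace PlanarWeb

variable {d : ℕ} {U U' U'' : TopologicalSpace.Opens Plane}

theorem LocallyEquivalentAt.trans {W : PlanarWeb d U} {W' : PlanarWeb d U'}
    {W'' : PlanarWeb d U''} {p : Plane} {φ : OpenPartialHomeomorph Plane Plane}
    (hp : p ∈ φ.source) (hU : φ.source ⊆ (U : Set Plane))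
    (hφ : ContDiffOn ℝ ∞ φ φ.source) (hφ' : ContDiffOn ℝ ∞ φ.symm φ.target)
    (hdir : ∀ q ∈ φ.source, ∀ i,
      (W'.fol i).dir (φ q) = ((W.fol i).dir q).map (fderiv ℝ φ q).toLinearMap)
    (h : W'.LocallyEquivalentAt W'' (φ p)) : W.LocallyEquivalentAt W'' p := by
  obtain ⟨ψ, hψp, -, hψt, hψ, hψ', hψdir⟩ := h
  have hsrc : (φ.trans ψ).source = φ.source ∩ φ ⁻¹' ψ.source := φ.trans_source ψ
  have htgt : (φ.trans ψ).target = ψ.target ∩ ψ.symm ⁻¹' φ.target := φ.trans_target ψ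
  refine ⟨φ.trans ψ, ?_, ?_, ?_, ?_, ?_, ?_⟩
  · rw [hsrc]; exact ⟨hp, hψp⟩
  · rw [hsrc]; exact Set.inter_subset_left.trans hU
  · rw [htgt]; exact Set.inter_subset_left.trans hψt
  · rw [hsrc, OpenPartialHomeomorph.coe_trans]
    exact hψ.comp (hφ.mono Set.inter_subset_left) fun q hq => hq.2
  · rw [htgt, OpenPartialHomeomorph.coe_trans_symm]
    exact hφ'.comp (hψ'.mono Set.inter_subset_left) fun q hq => hq.2
  · intro q hq i
    rw [hsrc] at hq
    have d1 : DifferentiableAt ℝ φ q :=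
      (hφ.contDiffAt (φ.open_source.mem_nhds hq.1)).differentiableAt (by simp)
    have d2 : DifferentiableAt ℝ ψ (φ q) :=
      (hψ.contDiffAt (ψ.open_source.mem_nhds hq.2)).differentiableAt (by simp)
    rw [OpenPartialHomeomorph.coe_trans, fderiv_comp q d2 d1, Function.comp_apply,
      hψdir _ hq.2 i, hdir q hq.1 i, ← Submodule.map_comp]
    rfl

/-- The basic invariant of a `4`-web is preserved by local diffeomorphisms. -/
theorem IsBasicInvariantAt.map {W : PlanarWeb 4 U} {W' : PlanarWeb 4 U'}
    {φ : OpenPartialHomeomorph Plane Plane}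
    (hφ : ContDiffOn ℝ ∞ φ φ.source) (hφ' : ContDiffOn ℝ ∞ φ.symm φ.target)
    {q : Plane} (hq : q ∈ φ.source)
    (hdir : ∀ i, (W'.fol i).dir (φ q) = ((W.fol i).dir q).map (fderiv ℝ φ q).toLinearMap)
    {a : ℝ} (h : W.IsBasicInvariantAt q a) : W'.IsBasicInvariantAt (φ q) a := by
  have d1 : HasFDerivAt φ (fderiv ℝ φ q) q :=
    ((hφ.contDiffAt (φ.open_source.mem_nhds hq)).differentiableAt (by simp)).hasFDerivAt
  have d2 : HasFDerivAt φ.symm (fderiv ℝ φ.symm (φ q)) (φ q) :=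
    ((hφ'.contDiffAt (φ.open_target.mem_nhds (φ.map_source hq))).differentiableAt
      (by simp)).hasFDerivAt
  -- `L` and `M` are mutually inverse, and composing the normalized covectors with `M` preserves
  -- their linear relations, hence `a`.
  set L := fderiv ℝ φ q
  set M := fderiv ℝ φ.symm (φ q)
  have hML : ∀ v, M (L v) = v := by
    have e : (φ.symm ∘ φ : Plane → Plane) =ᶠ[nhds q] id := φ.eventually_left_inverse hq
    have := (d2.comp q d1).unique ((hasFDerivAt_id q).congr_of_eventuallyEq e)
    exact fun v => DFunLike.congr_fun this v
  have hLM : ∀ v, L (M v) = v := by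
    have e : (φ ∘ φ.symm : Plane → Plane) =ᶠ[nhds (φ q)] id :=
      φ.eventually_right_inverse (φ.map_source hq)
    have d1' : HasFDerivAt φ L (φ.symm (φ q)) := by rwa [φ.left_inv hq]
    have := (d1'.comp (φ q) d2).unique ((hasFDerivAt_id (φ q)).congr_of_eventuallyEq e)
    exact fun v => DFunLike.congr_fun this v
  obtain ⟨η, hη, h1, h2⟩ := h
  refine ⟨fun i => (η i).comp M, fun i => ⟨fun h0 => (hη i).1 ?_, ?_⟩, ?_, ?_⟩
  · refine ContinuousLinearMap.ext fun v => ?_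
    have := DFunLike.congr_fun h0 (L v)
    simpa [hML] using this
  · rw [hdir i, (hη i).2]
    ext w
    simp only [Submodule.mem_map, LinearMap.mem_ker, ContinuousLinearMap.coe_coe,
      ContinuousLinearMap.comp_apply]
    constructor
    · rintro ⟨v, hv, rfl⟩
      rwa [hML]
    · exact fun hw => ⟨M w, hw, hLM w⟩
  · rw [← ContinuousLinearMap.add_comp, ← ContinuousLinearMap.add_comp, h1,
      ContinuousLinearMap.zero_comp]
  · rw [← ContinuousLinearMap.smul_comp, ← ContinuousLinearMap.add_comp,
      ← ContinuousLinearMap.add_comp, h2, ContinuousLinearMap.zero_comp]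

theorem IsParallelizable.isLinearizable {W : PlanarWeb d U} (h : W.IsParallelizable) :
    W.IsLinearizable := by
  intro p hp
  obtain ⟨U', W', hW', he⟩ := h p hp
  exact ⟨U', W', fun i q r hseg _ => hW' i r (hseg (right_mem_segment ℝ q r)) q
    (hseg (left_mem_segment ℝ q r)), he⟩

/-! ### Normalized forms and parallelizing coordinates. -/

/-- Three foliations of a web, normalized as the kernels of `ω`, `ω'` and `ω + ω'`. -/
theorem exists_normalized_forms (W : PlanarWeb d U) {i j k : Fin d} (hij : i ≠ j) (hik : i ≠ k)
    (hjk : j ≠ k) {z : Plane} (hz : z ∈ U) {N : Set Plane} (hN : IsOpen N) (hzN : z ∈ N) :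
    ∃ (B : Set Plane) (p q p' q' : Plane → ℝ), IsOpen B ∧ Convex ℝ B ∧ z ∈ B ∧ B ⊆ N ∧ B ⊆ U ∧
      ContDiffOn ℝ ∞ p B ∧ ContDiffOn ℝ ∞ q B ∧ ContDiffOn ℝ ∞ p' B ∧ ContDiffOn ℝ ∞ q' B ∧
      (∀ w ∈ B, p w * q' w - q w * p' w ≠ 0) ∧
      ∀ w ∈ B, (W.fol i).dir w = LinearMap.ker (covec (p w) (q w)).toLinearMap ∧
        (W.fol j).dir w = LinearMap.ker (covec (p' w) (q' w)).toLinearMap ∧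
        (W.fol k).dir w = LinearMap.ker (covec (p w + p' w) (q w + q' w)).toLinearMap := by
  obtain ⟨V, hzV, hVU, θ, hθ, hθV⟩ := (W.fol i).smooth z hz
  obtain ⟨V', hzV', -, θ', hθ', hθV'⟩ := (W.fol j).smooth z hz
  obtain ⟨V'', hzV'', -, θ'', hθ'', hθV''⟩ := (W.fol k).smooth z hz
  obtain ⟨ε, hε, hball⟩ := Metric.isOpen_iff.1
    (((V.isOpen.inter V'.isOpen).inter V''.isOpen).inter hN) z ⟨⟨⟨hzV, hzV'⟩, hzV''⟩, hzN⟩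
  set B := Metric.ball z ε
  have hBV : B ⊆ V := fun w hw => (hball hw).1.1.1
  have hBV' : B ⊆ V' := fun w hw => (hball hw).1.1.2
  have hBV'' : B ⊆ V'' := fun w hw => (hball hw).1.2
  have hBU : B ⊆ U := fun w hw => hVU (hBV hw)
  have comp : ∀ (α : Plane → (Plane →L[ℝ] ℝ)) (S : Set Plane), ContDiffOn ℝ ∞ α S → B ⊆ S →
      ∀ v, ContDiffOn ℝ ∞ (fun w => α w v) B := fun α S hα hS v =>
    (hα.mono hS).clm_apply contDiffOn_const
  have a1 := comp θ V hθ hBV (1, 0)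
  have a2 := comp θ V hθ hBV (0, 1)
  have b1 := comp θ' V' hθ' hBV' (1, 0)
  have b2 := comp θ' V' hθ' hBV' (0, 1)
  have c1 := comp θ'' V'' hθ'' hBV'' (1, 0)
  have c2 := comp θ'' V'' hθ'' hBV'' (0, 1)
  have dij : ∀ w ∈ B, θ w (1, 0) * θ' w (0, 1) - θ w (0, 1) * θ' w (1, 0) ≠ 0 := fun w hw h =>
    W.general_position w (hBU hw) i j hij (by
      rw [(hθV w (hBV hw)).2, (hθV' w (hBV' hw)).2]
      exact ker_eq_of_det_eq_zero (hθV w (hBV hw)).1 (hθV' w (hBV' hw)).1 h)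
  have dik : ∀ w ∈ B, θ w (1, 0) * θ'' w (0, 1) - θ w (0, 1) * θ'' w (1, 0) ≠ 0 := fun w hw h =>
    W.general_position w (hBU hw) i k hik (by
      rw [(hθV w (hBV hw)).2, (hθV'' w (hBV'' hw)).2]
      exact ker_eq_of_det_eq_zero (hθV w (hBV hw)).1 (hθV'' w (hBV'' hw)).1 h)
  have djk : ∀ w ∈ B, θ' w (1, 0) * θ'' w (0, 1) - θ' w (0, 1) * θ'' w (1, 0) ≠ 0 := fun w hw h =>
    W.general_position w (hBU hw) j k hjk (by
      rw [(hθV' w (hBV' hw)).2, (hθV'' w (hBV'' hw)).2]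
      exact ker_eq_of_det_eq_zero (hθV' w (hBV' hw)).1 (hθV'' w (hBV'' hw)).1 h)
  -- The factors come from the identity `(θ'∧θ'')θ - (θ∧θ'')θ' + (θ∧θ')θ'' = 0` in a plane: its
  -- first two terms serve as `ω` and `ω'`, and their sum is a multiple of `θ''`.
  have s1 := (b1.mul c2).sub (b2.mul c1)
  have s2 := ((a1.mul c2).sub (a2.mul c1)).neg
  refine ⟨B, _, _, _, _, Metric.isOpen_ball, convex_ball z ε, Metric.mem_ball_self hε,
    fun w hw => (hball hw).2, hBU, s1.mul a1, s1.mul a2, s2.mul b1, s2.mul b2, ?_, ?_⟩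
  · intro w hw h
    refine mul_ne_zero (mul_ne_zero (dij w hw) (dik w hw)) (djk w hw) ?_
    linear_combination -h
  · intro w hw
    refine ⟨?_, ?_, ?_⟩
    · rw [(hθV w (hBV hw)).2]
      refine ker_eq_of_forall_mul_eq (djk w hw) one_ne_zero fun v => ?_
      rw [covec_apply, clm_apply_eq (θ w) v]
      ring
    · rw [(hθV' w (hBV' hw)).2]
      refine ker_eq_of_forall_mul_eq (neg_ne_zero.2 (dik w hw)) one_ne_zero fun v => ?_
      rw [covec_apply, clm_apply_eq (θ' w) v]
      ring
    · rw [(hθV'' w (hBV'' hw)).2]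
      refine ker_eq_of_forall_mul_eq (neg_ne_zero.2 (dij w hw)) one_ne_zero fun v => ?_
      rw [covec_apply, clm_apply_eq (θ'' w) v]
      ring

/-- The fourth foliation of a `4`-web, in terms of the normalized forms of the other three. -/
theorem IsBasicInvariantAt.dir_eq {W : PlanarWeb 4 U} {z : Plane} (hz : z ∈ U) {c : ℝ}
    (h : W.IsBasicInvariantAt z c) {p q p' q' : ℝ} (hdet : p * q' - q * p' ≠ 0)
    (h0 : (W.fol 0).dir z = LinearMap.ker (covec p q).toLinearMap)
    (h1 : (W.fol 1).dir z = LinearMap.ker (covec p' q').toLinearMap)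
    (h2 : (W.fol 2).dir z = LinearMap.ker (covec (p + p') (q + q')).toLinearMap) :
    (W.fol 3).dir z = LinearMap.ker (covec (c * p + p') (c * q + q')).toLinearMap ∧
      c ≠ 0 ∧ c ≠ 1 := by
  have h3 : (W.fol 3).dir z = LinearMap.ker (covec (c * p + p') (c * q + q')).toLinearMap := by
    obtain ⟨η, hη, e1, e2⟩ := h
    obtain ⟨k0, hk0⟩ := exists_eq_smul_of_ker_eq (hη 0).1 ((hη 0).2.symm.trans h0)
    obtain ⟨k1, hk1⟩ := exists_eq_smul_of_ker_eq (hη 1).1 ((hη 1).2.symm.trans h1)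
    obtain ⟨k2, hk2⟩ := exists_eq_smul_of_ker_eq (hη 2).1 ((hη 2).2.symm.trans h2)
    have f0 := fun v : Plane => DFunLike.congr_fun hk0 v
    have f1 := fun v : Plane => DFunLike.congr_fun hk1 v
    have f2 := fun v : Plane => DFunLike.congr_fun hk2 v
    have g1 := fun v : Plane => DFunLike.congr_fun e1 v
    have g2 := fun v : Plane => DFunLike.congr_fun e2 v
    simp only [covec_apply, smul_apply, add_apply, zero_apply, smul_eq_mul] at f0 f1 f2 g1 g2
    have hdet01 : η 0 (1, 0) * η 1 (0, 1) - η 0 (0, 1) * η 1 (1, 0) ≠ 0 := by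
      intro h'
      refine W.general_position z hz 0 1 (by decide) ?_
      rw [(hη 0).2, (hη 1).2]
      exact ker_eq_of_det_eq_zero (hη 0).1 (hη 1).1 h'
    -- Two normalizations of three forms differ by a common factor: comparing relations gives `k0 =
    -- k1 = -k2`, hence `cω + ω' = -k0 • η 3`.
    have r := eq_zero_of_two_relations (x := k0 + k2) (y := k1 + k2)
      (a := η 0 (1, 0)) (b := η 1 (1, 0)) (c := η 0 (0, 1)) (d := η 1 (0, 1))
      (fun h' => hdet01 (by linear_combination h'))
      (by linear_combination f2 (1, 0) - f0 (1, 0) - f1 (1, 0) + k2 * g1 (1, 0))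
      (by linear_combination f2 (0, 1) - f0 (0, 1) - f1 (0, 1) + k2 * g1 (0, 1))
    have hk : k0 ≠ 0 := by
      rintro rfl
      have := f0 (1, 0)
      have := f0 (0, 1)
      apply hdet
      simp at *
      simp [*]
    rw [(hη 3).2]
    refine ker_eq_of_forall_mul_eq (neg_ne_zero.2 hk) one_ne_zero fun v => ?_
    rw [covec_apply]
    linear_combination -c * f0 v - f1 v - k0 * g2 v + (r.1 - r.2) * η 1 v
  refine ⟨h3, ?_, ?_⟩
  · rintro rfl
    refine W.general_position z hz 3 1 (by decide) ?_
    rw [h3, h1]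
    simp
  · rintro rfl
    refine W.general_position z hz 3 2 (by decide) ?_
    rw [h3, h2]
    simp

/-- A web whose foliations are defined by constant combinations of two forms `ρ⁻¹ dx`, `ρ⁻¹ dy`
is parallelized by the coordinates `x`, `y`. -/
theorem exists_isParallel_of_coordinates (W : PlanarWeb d U) {B : Set Plane} (hB : IsOpen B)
    (hBU : B ⊆ U) {p q p' q' x y ρ : Plane → ℝ} (hx : ContDiffOn ℝ ∞ x B)
    (hy : ContDiffOn ℝ ∞ y B) (hdet : ∀ z ∈ B, p z * q' z - q z * p' z ≠ 0)
    (hxy : ∀ z ∈ B, ρ z ≠ 0 ∧ pd (1, 0) x z = ρ z * p z ∧ pd (0, 1) x z = ρ z * q z ∧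
        pd (1, 0) y z = ρ z * p' z ∧ pd (0, 1) y z = ρ z * q' z)
    (s t : Fin d → ℝ)
    (hst : ∀ i, ∀ z ∈ B, (W.fol i).dir z =
      LinearMap.ker (covec (s i * p z + t i * p' z) (s i * q z + t i * q' z)).toLinearMap)
    {z : Plane} (hz : z ∈ B) :
    ∃ (U' : TopologicalSpace.Opens Plane) (W' : PlanarWeb d U'),
      W'.IsParallel ∧ W.LocallyEquivalentAt W' z := by
  -- If `s i = t i = 0`, the tangent line would be the whole plane.
  have hne : ∀ i, covec (s i) (t i) ≠ 0 := by
    intro i h0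
    have h1 := DFunLike.congr_fun h0 (1, 0)
    have h2 := DFunLike.congr_fun h0 (0, 1)
    simp only [covec_apply, mul_one, mul_zero, add_zero, zero_add, zero_apply] at h1 h2
    obtain ⟨V, hV, -, θ, -, hθ⟩ := (W.fol i).smooth z (hBU hz)
    have hd := (hθ z hV).2
    rw [hst i z hz, h1, h2] at hd
    apply (hθ z hV).1
    refine ContinuousLinearMap.ext fun v => ?_
    have : v ∈ LinearMap.ker (θ z).toLinearMap := by
      rw [← hd]
      simp
    simpa using this
  have hdet' : ∀ z ∈ B,
      pd (1, 0) x z * pd (0, 1) y z - pd (0, 1) x z * pd (1, 0) y z ≠ 0 := by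
    intro z hz
    obtain ⟨h0, h1, h2, h3, h4⟩ := hxy z hz
    rw [h1, h2, h3, h4]
    exact fun h => mul_ne_zero (mul_ne_zero h0 h0) (hdet z hz) (by linear_combination h)
  refine ⟨⊤, ⟨fun i => ⟨fun _ => LinearMap.ker (covec (s i) (t i)).toLinearMap, fun w _ =>
    ⟨⊤, trivial, le_rfl, fun _ => covec (s i) (t i), contDiffOn_const, fun _ _ =>
      ⟨hne i, rfl⟩⟩⟩, ?_⟩, fun i _ _ _ _ => rfl, ?_⟩
  · intro _ _ i j hij h
    refine W.general_position z (hBU hz) i j hij ?_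
    rw [hst i z hz, hst j z hz]
    ext v
    -- At the point `(ω(v), ω'(v))`, the covector `covec (s i) (t i)` takes the value of `(s i)ω +
    -- (t i)ω'` on `v`, so coinciding model directions would give coinciding directions of `W` at
    -- `z`.
    have := SetLike.ext_iff.1 h (p z * v.1 + q z * v.2, p' z * v.1 + q' z * v.2)
    simp only [LinearMap.mem_ker, ContinuousLinearMap.coe_coe, covec_apply] at this ⊢
    convert this using 2 <;> ring
  · obtain ⟨φ, hφz, hφB, hφ, hφs, hφs'⟩ := exists_local_coordinates hB hx hy hdet' hz
    refine ⟨φ, hφz, hφB.trans hBU, fun _ _ => trivial, hφs, hφs', fun w hw i => ?_⟩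
    have hwB := hφB hw
    have hfun : (φ : Plane → Plane) = fun z => (x z, y z) := funext hφ
    rw [hfun, (hasFDerivAt_prodMk_planeEquiv hB hx hy hwB (hdet' w hwB)).fderiv, hst i w hwB]
    obtain ⟨h0, h1, h2, h3, h4⟩ := hxy w hwB
    set L := planeEquiv _ _ _ _ (hdet' w hwB) with hL
    have key : ∀ v : Plane, covec (s i) (t i) (L v) =
        ρ w * covec (s i * p w + t i * p' w) (s i * q w + t i * q' w) v := by
      intro v
      simp only [hL, planeEquiv_apply, covec_apply, h1, h2, h3, h4]
      ring
    ext v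
    simp only [Submodule.mem_map, LinearMap.mem_ker, ContinuousLinearMap.coe_coe,
      ContinuousLinearEquiv.coe_coe]
    constructor
    · intro hv
      refine ⟨L.symm v, ?_, L.apply_symm_apply v⟩
      have := key (L.symm v)
      rw [L.apply_symm_apply, hv] at this
      exact (mul_eq_zero.1 this.symm).resolve_left h0
    · rintro ⟨u, hu, rfl⟩
      rw [key, hu, mul_zero]

/-! ### From linear to parallel webs. -/

/-- A linear web with constant basic invariants is parallelizable. -/
theorem IsLinear.exists_isParallel (hd : 4 ≤ d) {W : PlanarWeb d U} (hW : W.IsLinear)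
    {z : Plane} (hz : z ∈ U) {N : Set Plane} (hN : IsOpen N) (hzN : z ∈ N)
    (hconst : ∀ e : Fin 4 ↪o Fin d, ∃ c : ℝ, ∀ q ∈ N, (W.subweb e).IsBasicInvariantAt q c) :
    ∃ (U' : TopologicalSpace.Opens Plane) (W' : PlanarWeb d U'),
      W'.IsParallel ∧ W.LocallyEquivalentAt W' z := by
  obtain ⟨B, p, q, p', q', hB, hBc, hzB, hBN, hBU, hp, hq, hp', hq', hdet, hdir⟩ :=
    W.exists_normalized_forms (i := ⟨0, by omega⟩) (j := ⟨1, by omega⟩) (k := ⟨2, by omega⟩)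
      (by simp) (by simp) (by simp) hz hN hzN
  have hfourth : ∀ i : Fin d, 3 ≤ (i : ℕ) → ∃ c : ℝ, c ≠ 0 ∧ c ≠ 1 ∧ ∀ w ∈ B,
      (W.fol i).dir w = LinearMap.ker (covec (c * p w + p' w) (c * q w + q' w)).toLinearMap := by
    intro i hi
    -- Subwebs keep the given order, so the foliations 0, 1, 2 are completed by any later one; its
    -- invariant is the constant `c`.
    have hmono : StrictMono (![⟨0, by omega⟩, ⟨1, by omega⟩, ⟨2, by omega⟩, i] : Fin 4 → Fin d) := by
      rw [Fin.strictMono_iff_lt_succ]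
      intro j
      fin_cases j
      · simp
      · simp
      · simp only [Fin.lt_def]
        exact hi
    obtain ⟨c, hc⟩ := hconst (OrderEmbedding.ofStrictMono _ hmono)
    have H := fun w (hw : w ∈ B) => (hc w (hBN hw)).dir_eq (hBU hw) (hdet w hw) (hdir w hw).1
      (hdir w hw).2.1 (hdir w hw).2.2
    exact ⟨c, (H z hzB).2.1, (H z hzB).2.2, fun w hw => (H w hw).1⟩
  have hall : ∀ i : Fin d, ∃ s t : ℝ, ∀ w ∈ B, (W.fol i).dir w =
      LinearMap.ker (covec (s * p w + t * p' w) (s * q w + t * q' w)).toLinearMap := by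
    rintro ⟨i, hi⟩
    rcases Nat.lt_or_ge i 3 with h | h
    · interval_cases i
      · exact ⟨1, 0, fun w hw => by simpa using (hdir w hw).1⟩
      · exact ⟨0, 1, fun w hw => by simpa using (hdir w hw).2.1⟩
      · exact ⟨1, 1, fun w hw => by simpa using (hdir w hw).2.2⟩
    · obtain ⟨c, -, -, hc⟩ := hfourth ⟨i, hi⟩ h
      exact ⟨c, 1, fun w hw => by simpa using hc w hw⟩
  have hstraight : ∀ (i : Fin d) (s t : ℝ), (∀ w ∈ B, (W.fol i).dir w =
      LinearMap.ker (covec (s * p w + t * p' w) (s * q w + t * q' w)).toLinearMap) → ∀ w ∈ B,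
      s ^ 3 * kerDeriv p q p q p q w +
        s ^ 2 * t * (kerDeriv p' q' p q p q w + kerDeriv p q p q p' q' w
          + kerDeriv p q p' q' p q w) +
        s * t ^ 2 * (kerDeriv p q p' q' p' q' w + kerDeriv p' q' p q p' q' w
          + kerDeriv p' q' p' q' p q w) +
        t ^ 3 * kerDeriv p' q' p' q' p' q' w = 0 := by
    intro i s t h w hw
    rw [← kerDeriv_comb (hp.differentiableAt_of_isOpen hB hw)
      (hq.differentiableAt_of_isOpen hB hw) (hp'.differentiableAt_of_isOpen hB hw)
      (hq'.differentiableAt_of_isOpen hB hw)]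
    exact (hW i).kerDeriv_eq_zero hB hBU
      ((contDiffOn_const.mul hp).add (contDiffOn_const.mul hp'))
      ((contDiffOn_const.mul hq).add (contDiffOn_const.mul hq')) h hw
  obtain ⟨c, hc0, hc1, hc⟩ := hfourth ⟨3, by omega⟩ le_rfl
  -- The roots `(1:0)`, `(0:1)`, `(1:1)`, `(c:1)` are distinct because `c` is neither 0 nor 1.
  have hzero := fun w (hw : w ∈ B) => cubic_form_eq_zero hc0 hc1 fun s t hst => by
    rcases hst with ⟨rfl, rfl⟩ | ⟨rfl, rfl⟩ | ⟨rfl, rfl⟩ | ⟨rfl, rfl⟩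
    · exact hstraight ⟨0, by omega⟩ 1 0 (fun w hw => by simpa using (hdir w hw).1) w hw
    · exact hstraight ⟨1, by omega⟩ 0 1 (fun w hw => by simpa using (hdir w hw).2.1) w hw
    · exact hstraight ⟨2, by omega⟩ 1 1 (fun w hw => by simpa using (hdir w hw).2.2) w hw
    · exact hstraight ⟨3, by omega⟩ _ 1 (fun w hw => by simpa using hc w hw) w hw
  obtain ⟨μ₁, μ₂, σ₁, σ₂, hμ₁, hμ₂, hσ₁, hσ₂, h, h'⟩ := exists_isProjParallel hB hp hq hp' hq' hdet
    (fun w hw => (hzero w hw).1) (fun w hw => (hzero w hw).2.1)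
    (fun w hw => (hzero w hw).2.2.1) (fun w hw => (hzero w hw).2.2.2)
  obtain ⟨x, y, ρ, hx, hy, hxy⟩ :=
    h.exists_coordinates h' hB hBc hμ₁ hμ₂ hσ₁ hσ₂ hp hq hp' hq' hdet
  choose s t hst using hall
  exact W.exists_isParallel_of_coordinates hB hBU hx hy hdet hxy s t hst hzB

end PlanarWeb

theorem mainTheorem9 (d : ℕ) (hd : 4 ≤ d) (U : TopologicalSpace.Opens Plane)
    (W : PlanarWeb d U)
    (hconst : ∀ e : Fin 4 ↪o Fin d, ∃ c : ℝ, ∀ q ∈ U, (W.subweb e).basicInvariant q = c) :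
    W.IsLinearizable ↔ W.IsParallelizable := by
  refine ⟨fun h z hz => ?_, fun h => h.isLinearizable⟩
  obtain ⟨U', W', hW', φ, hzφ, hφU, hφU', hφ, hφ', hdir⟩ := h z hz
  -- Constancy of the invariants of `W'` is only known on the image `φ.target`, which therefore
  -- plays the role of `N`.
  obtain ⟨U'', W'', hW'', he⟩ := hW'.exists_isParallel hd (hφU' (φ.map_source hzφ))
    φ.open_target (φ.map_source hzφ) (by
      intro e
      obtain ⟨c, hc⟩ := hconst e
      refine ⟨c, fun q hq => ?_⟩
      have hs := φ.map_target hq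
      have := PlanarWeb.IsBasicInvariantAt.map (W := W.subweb e) (W' := W'.subweb e)
        (h := ((W.subweb e).isBasicInvariantAt_iff (hφU hs) c).2 (hc _ (hφU hs))) hφ hφ' hs (fun i => hdir _ hs (e i))
      rwa [φ.right_inv hq] at this)
  exact ⟨U'', W'', hW'', PlanarWeb.LocallyEquivalentAt.trans hzφ hφU hφ hφ' hdir he⟩
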